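/- Let $d\in\mathbb{N}$ and let $\{S_i\}_{i\in\mathcal I}$ be a finite family of contracting similarities of $\mathbb{R}^d$, i.e. for each $i$ there is $c_i\in(0,1)$ with $\|S_i(x)-S_i(y)\|=c_i\|x-y\|$ for all $x,y\in\mathbb{R}^d$. Let $F\subset\mathbb{R}^d$ be its attractor, i.e. the non-empty compact set with $F=\bigcup_{i\in\mathcal I}S_i(F)$. For a non-empty finite word $\alpha=(i_1,\dots,i_k)$ over $\mathcal I$ write $S_\alpha=S_{i_1}\circ\cdots\circ S_{i_k}$, and let $$\mathcal E=\{S_\alpha^{-1}\circ S_\beta : \alpha,\beta \text{ non-empty finite words over } \mathcal I,\ \alpha\neq\beta\}.$$ The family satisfies the weak separation property if the identity $I$ does not belong to the closure of $\mathcal E\setminus\{I\}$ in the group of similarities of $\mathbb{R}^d$ with the topology of pointwise convergence. For $X\subset\mathbb{R}^d$ and $0<\rho<r$ let $\mathcal N_X(r,\rho)$ be the maximum over $x\in X$ of the smallest number of open balls of radius $\rho$ needed to cover $X\cap B_r(x)$, where $B_r(x)$ is the open ball of radius $r$ centred at $x$. The Assouad dimension $\dim_A X$ of a non-empty set $X$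 is the infimum of all $s\geq 0$ for which there is a constant $K_s$ with $\mathcal N_X(r,\rho)\le K_s(r/\rho)^s$ for all $0<\rho<r\le1$. If $F$ is not contained in any $(d-1)$-dimensional affine hyperplane of $\mathbb{R}^d$ and $\{S_i\}_{i\in\mathcal I}$ does not satisfy the weak separation property, then $\dim_A F\ge 1$. -/

import Mathlib

open scoped NNReal ENNReal

/-- The smallest number (in `ℕ∞`) of open balls of radius `ρ`, with centres anywhere in the
ambient space, that are required to cover `A`. -/
noncomputable def openCoverNumber {X : Type*} [MetricSpace X] (A : Set X) (ρ : ℝ) : ℕ∞ :=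
  ⨅ (C : Set X) (_ : A ⊆ ⋃ x ∈ C, Metric.ball x ρ), C.encard

/-- The largest number of open `ρ`-balls needed to cover `A ∩ B_r(x)`, over all centres
`x ∈ A`. -/
noncomputable def localCoverNumber {X : Type*} [MetricSpace X] (A : Set X) (r ρ : ℝ) : ℕ∞ :=
  ⨆ x ∈ A, openCoverNumber (A ∩ Metric.ball x r) ρ

/-- The Assouad dimension: the infimum of all `s ≥ 0` for which there is a constant `K` with
`localCoverNumber A r ρ ≤ K (r / ρ) ^ s` whenever `0 < ρ < r ≤ 1`.  (For a non-empty set no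
negative exponent can satisfy the condition.) -/
noncomputable def assouadDim {X : Type*} [MetricSpace X] (A : Set X) : ℝ≥0∞ :=
  ⨅ (s : ℝ≥0) (_ : ∃ K : ℝ≥0, ∀ r ρ : ℝ, 0 < ρ → ρ < r → r ≤ 1 →
    (localCoverNumber A r ρ : ℝ≥0∞) ≤ K * ENNReal.ofReal ((r / ρ) ^ (s : ℝ))), (s : ℝ≥0∞)

/-- `X ≃ᵈ X` is the group of similarities of `X` (multiplication is composition).  It carries
the topology of pointwise convergence. -/
instance DilationEquiv.pointwiseTopology {X : Type*} [MetricSpace X] :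
    TopologicalSpace (X ≃ᵈ X) :=
  TopologicalSpace.induced (fun T : X ≃ᵈ X => (T : X → X)) inferInstance

/-- A similarity with ratio `c ∈ (0, 1)`. -/
def IsContractingSimilarity {X : Type*} [MetricSpace X] (T : X ≃ᵈ X) : Prop :=
  ∃ c : ℝ, 0 < c ∧ c < 1 ∧ ∀ x y : X, dist (T x) (T y) = c * dist x y

/-- `F` is the attractor of the system `S`: a non-empty compact set with `F = ⋃ i, S i (F)`. -/
def IsAttractor {X ι : Type*} [MetricSpace X] (S : ι → (X ≃ᵈ X)) (F : Set X) : Prop :=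
  F.Nonempty ∧ IsCompact F ∧ F = ⋃ i, S i '' F

/-- `S_α = S_{i₁} ∘ ⋯ ∘ S_{iₖ}` for the word `α = (i₁, …, iₖ)`. -/
def wordMap {X ι : Type*} [MetricSpace X] (S : ι → (X ≃ᵈ X)) (α : List ι) : X ≃ᵈ X :=
  (α.map S).prod

/-- The set `ℰ` of all `S_α⁻¹ ∘ S_β`, for distinct non-empty finite words `α`, `β`. -/
def wordQuotients {X ι : Type*} [MetricSpace X] (S : ι → (X ≃ᵈ X)) : Set (X ≃ᵈ X) :=
  {T | ∃ α β : List ι, α ≠ [] ∧ β ≠ [] ∧ α ≠ β ∧ T = (wordMap S α)⁻¹ * wordMap S β}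

/-- The weak separation property: the identity is not in the closure of `ℰ` without the
identity. -/
def WeakSeparationProperty {X ι : Type*} [MetricSpace X] (S : ι → (X ≃ᵈ X)) : Prop :=
  (1 : X ≃ᵈ X) ∉ closure (wordQuotients S \ {1})

/-- A `(d - 1)`-dimensional affine hyperplane of `ℝ^d`. -/
def IsAffineHyperplane {d : ℕ} (H : AffineSubspace ℝ (EuclideanSpace ℝ (Fin d))) : Prop :=
  (H : Set (EuclideanSpace ℝ (Fin d))).Nonempty ∧ Module.finrank ℝ H.direction + 1 = d

-- Failure of weak separation gives quotients `T = S_α⁻¹ S_β ≠ 1` arbitrarily close to the identity.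
-- The displacement `T - 1` is affine. Since `F` spans, its Lipschitz constant is at most a constant
-- times its value at some `p` in a fixed finite subset of `F`, so it is nearly constant close to
-- `p`. For a word map `A` carrying the unit ball about `x` close to `p`, the conjugate `A⁻¹ T A` is
-- again a quotient of word maps. It moves this ball almost like a translation, with displacement
-- magnified by the inverse ratio of `A`; lengthening the word of `A` tunes that displacement to any
-- prescribed small size `ε` (`exists_displacement_step`).
--
-- Each step prepends letters to the current word `w`, so points that `S_w` sends into `F` can be
-- kept or moved, and the longer word sends either choice into `F`. The directions vary, but
-- finitely many functionals detect them all; by pigeonhole many steps share one functional, and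
-- moving only at those steps gives a progression of points along which it increases. A single word
-- map sends this progression into `F` (`exists_separated_points`). Thus some ball of radius `r`
-- contains `N` points of `F` with gaps at least of order `r / N`, for every `N`, which forces
-- dimension at least one.

open Dilation (ratio)

/-- The displacement of a conjugate `A⁻¹ T A` in terms of the displacement of `T`. -/
theorem DilationEquiv.norm_conj_displacement {E : Type*} [NormedAddCommGroup E]
    (A T : E ≃ᵈ E) (x : E) :
    ‖(A⁻¹ * (T * A)) x - x‖ = (ratio A : ℝ)⁻¹ * ‖T (A x) - A x‖ := by
  have h : x = A⁻¹ (A x) := by simp [DilationEquiv.coe_inv]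
  have h2 : (A⁻¹ * (T * A)) x = A⁻¹ (T (A x)) := rfl
  conv_lhs => rw [h2]; enter [1, 2]; rw [h]
  rw [← dist_eq_norm, Dilation.dist_eq, DilationEquiv.ratio_inv, dist_eq_norm, NNReal.coe_inv]

-- Displacements of similarities and norming functionals

section Similarities

variable {E : Type*} [NormedAddCommGroup E] [NormedSpace ℝ E]

/-- By the Mazur-Ulam theorem, every similarity of a real normed space has a linear part. -/
theorem DilationEquiv.exists_linearPart (T : E ≃ᵈ E) :
    ∃ L : E →ₗ[ℝ] E, (∀ x y, T x - T y = L (x - y)) ∧ ∀ v, ‖L v‖ = ratio T * ‖v‖ := by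
  have hr : (0 : ℝ) < ratio T := by exact_mod_cast Dilation.ratio_pos T
  let c : ℝ := ratio T
  let scale : E ≃ E :=
    { toFun := fun x => c⁻¹ • x
      invFun := fun x => c • x
      left_inv := fun x => by simp [smul_smul, c, hr.ne']
      right_inv := fun x => by simp [smul_smul, c, hr.ne'] }
  -- Rescaling the argument by the inverse ratio turns `T` into a surjective isometry, to which
  -- Mazur-Ulam applies.
  let f : E ≃ᵢ E := IsometryEquiv.mk (scale.trans T.toEquiv) (by
    refine Isometry.of_dist_eq fun x y => ?_
    change dist (T (c⁻¹ • x)) (T (c⁻¹ • y)) = _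
    rw [Dilation.dist_eq, dist_smul₀, Real.norm_of_nonneg (inv_nonneg.2 hr.le), ← mul_assoc,
      mul_inv_cancel₀ hr.ne', one_mul])
  have hf : ∀ x, f (c • x) = T x := fun x => by
    change T (c⁻¹ • c • x) = T x
    rw [smul_smul, inv_mul_cancel₀ hr.ne', one_smul]
  let O := f.toRealAffineIsometryEquiv
  have hO : ∀ x, O x = f x := fun x => rfl
  have key : ∀ x y, T x - T y = c • O.linearIsometryEquiv (x - y) := by
    intro x y
    have := O.toAffineEquiv.toAffineMap.linearMap_vsub (c • x) (c • y)
    simp only [vsub_eq_sub] at this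
    rw [← smul_sub, map_smul] at this
    have h2 : O (c • x) - O (c • y) = c • O.linearIsometryEquiv (x - y) := this.symm
    rw [← h2, hO, hO, hf, hf]
  refine ⟨c • O.linearIsometryEquiv.toLinearEquiv.toLinearMap, key, fun v => ?_⟩
  have := key v 0
  rw [sub_zero] at this
  change ‖c • O.linearIsometryEquiv v‖ = _
  rw [norm_smul, LinearIsometryEquiv.norm_map, Real.norm_of_nonneg hr.le]

/-- The linear part of `A⁻¹` carries the displacement of `T` at `A z` to that of the conjugate at
`z`, and it scales all norms by the same factor. -/
theorem DilationEquiv.norm_conj_displacement_sub (A T : E ≃ᵈ E) (x y : E) :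
    ‖((A⁻¹ * (T * A)) x - x) - ((A⁻¹ * (T * A)) y - y)‖ =
      (ratio A : ℝ)⁻¹ * ‖(T (A x) - A x) - (T (A y) - A y)‖ := by
  obtain ⟨L, hL, hn⟩ := (A⁻¹).exists_linearPart
  have h : ∀ z, (A⁻¹ * (T * A)) z - z = L (T (A z) - A z) := fun z => by
    rw [← hL]
    simp [DilationEquiv.coe_inv]
  rw [h, h, ← map_sub, hn, DilationEquiv.ratio_inv, NNReal.coe_inv]

/-- Finitely many points of a set that is not contained in a hyperplane control the Lipschitz
constant of the displacement of every similarity. -/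
theorem exists_finset_displacement_bound [FiniteDimensional ℝ E] {F : Set E} {p₀ : E}
    (hp₀ : p₀ ∈ F) (hspan : ⊤ ≤ Submodule.span ℝ ((fun p => p - p₀) '' F)) :
    ∃ Y : Finset E, (Y : Set E) ⊆ F ∧ ∃ C : ℝ, 0 < C ∧ ∀ T : E ≃ᵈ E, T ≠ 1 →
      ∃ p ∈ Y, 0 < ‖T p - p‖ ∧
        ∀ x y, ‖(T x - x) - (T y - y)‖ ≤ C * ‖T p - p‖ * ‖x - y‖ := by
  classical
  let b := Module.Basis.ofSpan hspan
  have := FiniteDimensional.fintypeBasisIndex b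
  obtain ⟨C, hC, hb⟩ := b.exists_opNorm_le (F := E)
  let Y : Finset E := insert p₀ (Finset.univ.image fun i => b i + p₀)
  have hYF : (Y : Set E) ⊆ F := by
    intro y hy
    rcases Finset.mem_insert.1 (Finset.mem_coe.1 hy) with rfl | hy
    · exact hp₀
    · obtain ⟨i, -, rfl⟩ := Finset.mem_image.1 hy
      obtain ⟨q, hq, h⟩ := Module.Basis.ofSpan_subset hspan (Set.mem_range_self i)
      have h' : b i = q - p₀ := h.symm
      simpa [h'] using hq
  refine ⟨Y, hYF, C * 2, by positivity, fun T hT => ?_⟩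
  obtain ⟨p, hp, hmax⟩ := Y.exists_max_image (fun p => ‖T p - p‖) ⟨p₀, by simp [Y]⟩
  obtain ⟨L, hL, -⟩ := T.exists_linearPart
  let G : E →L[ℝ] E := LinearMap.toContinuousLinearMap (L - LinearMap.id)
  have hG : ∀ x y, (T x - x) - (T y - y) = G (x - y) := fun x y => by
    have : G (x - y) = L (x - y) - (x - y) := rfl
    rw [this, ← hL]
    abel
  -- On a basis vector, `G` is a difference of displacements at two points of `Y`, hence at most
  -- twice the maximal one.
  have hbound : ‖G‖ ≤ C * (2 * ‖T p - p‖) := by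
    refine hb (by positivity) fun i => ?_
    have h := hG (b i + p₀) p₀
    rw [add_sub_cancel_right] at h
    rw [← h]
    refine (norm_sub_le _ _).trans ?_
    have h1 := hmax (b i + p₀) (by simp [Y])
    have h2 := hmax p₀ (by simp [Y])
    linarith
  have hlip : ∀ x y, ‖(T x - x) - (T y - y)‖ ≤ C * 2 * ‖T p - p‖ * ‖x - y‖ := fun x y => by
    rw [hG]
    refine (G.le_opNorm _).trans ?_
    rw [mul_assoc C]
    gcongr
  refine ⟨p, hp, ?_, hlip⟩
  -- If the maximal displacement vanished, the Lipschitz bound would force `T = 1`.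
  refine lt_of_le_of_ne (norm_nonneg _) fun h0 => hT ?_
  refine DilationEquiv.ext fun x => ?_
  have h1 := hlip x p
  have hp0 : T p - p = 0 := norm_eq_zero.1 h0.symm
  rw [hp0, norm_zero, mul_zero, zero_mul, sub_zero] at h1
  exact sub_eq_zero.1 (norm_le_zero_iff.1 h1)

/-- Finitely many functionals of norm at most one are enough to bound the norm from below. -/
theorem exists_finset_norming [FiniteDimensional ℝ E] [Nontrivial E] :
    ∃ D : Finset (E →L[ℝ] ℝ), D.Nonempty ∧ (∀ f ∈ D, ‖f‖ ≤ 1) ∧ ∀ z, ∃ f ∈ D, ‖z‖ / 2 ≤ f z := by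
  classical
  choose g hg hgz using fun z : E => exists_dual_vector'' ℝ z
  -- The functional norming `z` still exceeds `1 / 2` near `z`; compactness of the sphere leaves
  -- finitely many.
  obtain ⟨t, -, ht⟩ := (isCompact_sphere (0 : E) 1).elim_nhds_subcover
    (fun z => {u | (1 : ℝ) / 2 < g z u}) fun z hz => by
      refine (isOpen_lt continuous_const (g z).continuous).mem_nhds ?_
      have : ‖z‖ = 1 := by simpa using hz
      change (1 : ℝ) / 2 < g z z
      rw [hgz, this]
      norm_num
  have key : ∀ z : E, z ≠ 0 → ∃ f ∈ t.image g, ‖z‖ / 2 ≤ f z := fun z hz => by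
    have hz' : 0 < ‖z‖ := norm_pos_iff.2 hz
    have hmem : ‖z‖⁻¹ • z ∈ Metric.sphere (0 : E) 1 := by
      simp [norm_smul, hz'.ne']
    obtain ⟨w, hw, hlt⟩ := Set.mem_iUnion₂.1 (ht hmem)
    have hlt' : (1 : ℝ) / 2 < g w (‖z‖⁻¹ • z) := hlt
    refine ⟨g w, Finset.mem_image_of_mem _ hw, ?_⟩
    rw [map_smul, smul_eq_mul, ← div_eq_inv_mul, lt_div_iff₀ hz'] at hlt'
    linarith
  obtain ⟨z₀, hz₀⟩ := exists_ne (0 : E)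
  obtain ⟨f₀, hf₀, -⟩ := key z₀ hz₀
  refine ⟨t.image g, ⟨f₀, hf₀⟩, ?_, fun z => ?_⟩
  · intro f hf
    obtain ⟨w, -, rfl⟩ := Finset.mem_image.1 hf
    exact hg w
  · by_cases hz : z = 0
    · exact ⟨f₀, hf₀, by simp [hz]⟩
    · exact key z hz

end Similarities

-- Word maps, cylinders and quotients near the identity

section Words

variable {X ι : Type*} [MetricSpace X] {S : ι → (X ≃ᵈ X)} {F : Set X}

theorem wordMap_append (S : ι → (X ≃ᵈ X)) (α β : List ι) :
    wordMap S (α ++ β) = wordMap S α * wordMap S β := by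
  simp [wordMap]

theorem IsAttractor.wordMap_mem (hF : IsAttractor S F) (α : List ι) {x : X} (hx : x ∈ F) :
    wordMap S α x ∈ F := by
  induction α with
  | nil => simpa [wordMap] using hx
  | cons i α ih =>
    have h : wordMap S (i :: α) x = S i (wordMap S α x) := by simp [wordMap]
    rw [h, hF.2.2]
    exact Set.mem_iUnion.2 ⟨i, _, ih, rfl⟩

theorem ratio_wordMap_replicate (S : ι → (X ≃ᵈ X)) (i : ι) (k : ℕ) :
    ratio (wordMap S (List.replicate k i)) = ratio (S i) ^ k := by
  simp [wordMap]

theorem ratio_mul (A B : X ≃ᵈ X) : ratio (A * B) = ratio A * ratio B :=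
  map_mul DilationEquiv.ratioHom A B

theorem ratio_wordMap_le_one (hS : ∀ i, ratio (S i) < 1) (α : List ι) :
    ratio (wordMap S α) ≤ 1 := by
  induction α with
  | nil => simp [wordMap, DilationEquiv.one_def]
  | cons i α ih =>
    have h : wordMap S (i :: α) = S i * wordMap S α := by simp [wordMap]
    rw [h, ratio_mul]
    exact mul_le_one' (hS i).le ih

/-- Every point of the attractor is approximated by small cylinders. -/
theorem IsAttractor.exists_cylinder_subset [Finite ι] (hF : IsAttractor S F)
    (hS : ∀ i, ratio (S i) < 1) {p : X} (hp : p ∈ F) {δ : ℝ} (hδ : 0 < δ) :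
    ∃ γ : List ι, (ratio (wordMap S γ) : ℝ) ≤ δ ∧ ∀ y ∈ F, dist (wordMap S γ y) p ≤ δ := by
  have hne : Nonempty ι := by
    rw [hF.2.2] at hp
    obtain ⟨i, -⟩ := Set.mem_iUnion.1 hp
    exact ⟨i⟩
  obtain ⟨i₀, hi₀⟩ := Finite.exists_max fun i => ratio (S i)
  have key : ∀ n : ℕ, ∀ p ∈ F, ∃ γ : List ι, ∃ q ∈ F, wordMap S γ q = p ∧
      ratio (wordMap S γ) ≤ ratio (S i₀) ^ n := by
    intro n
    induction n with
    | zero =>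
      exact fun p hp =>
        ⟨[], p, hp, by simp [wordMap], by simp [wordMap, DilationEquiv.one_def]⟩
    | succ n ih =>
      intro p hp
      rw [hF.2.2] at hp
      obtain ⟨i, p', hp', rfl⟩ := Set.mem_iUnion.1 hp
      obtain ⟨γ, q, hq, h1, h2⟩ := ih p' hp'
      have h : wordMap S (i :: γ) = S i * wordMap S γ := by simp [wordMap]
      refine ⟨i :: γ, q, hq, by simp [h, h1], ?_⟩
      rw [h, ratio_mul, pow_succ']
      exact mul_le_mul' (hi₀ i) h2
  have hB := hF.2.1.isBounded
  -- The summand `1` lets one inequality bound both the ratio and the ratio times the diameter by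
  -- `δ`.
  have hD : 0 < Metric.diam F + 1 := by positivity
  obtain ⟨n, hn⟩ := exists_pow_lt_of_lt_one (div_pos hδ hD)
    (show (ratio (S i₀) : ℝ) < 1 by exact_mod_cast hS i₀)
  obtain ⟨γ, q, hq, rfl, h2⟩ := key n p hp
  have h3 : (ratio (wordMap S γ) : ℝ) ≤ δ / (Metric.diam F + 1) :=
    (show (ratio (wordMap S γ) : ℝ) ≤ (ratio (S i₀) : ℝ) ^ n by exact_mod_cast h2).trans hn.le
  rw [le_div_iff₀ hD] at h3
  have h0 : (0 : ℝ) ≤ ratio (wordMap S γ) := NNReal.coe_nonneg _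
  refine ⟨γ, ?_, fun y hy => ?_⟩
  · nlinarith [Metric.diam_nonneg (s := F)]
  · rw [Dilation.dist_eq]
    have := Metric.dist_le_diam_of_mem hB hy hq
    nlinarith

/-- If the weak separation property fails, there are quotients different from the identity that
move finitely many given points arbitrarily little. -/
theorem exists_wordQuotient_near_one (h : ¬ WeakSeparationProperty S) (Y : Finset X) {δ : ℝ}
    (hδ : 0 < δ) : ∃ T ∈ wordQuotients S, T ≠ 1 ∧ ∀ p ∈ Y, dist (T p) p < δ := by
  rw [WeakSeparationProperty, not_not, mem_closure_iff] at h
  have hopen : IsOpen (⋂ p ∈ Y, {T : X ≃ᵈ X | dist (T p) p < δ}) :=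
    isOpen_biInter_finset fun p _ => isOpen_lt
      (((continuous_apply p).comp continuous_induced_dom).dist continuous_const) continuous_const
  obtain ⟨T, hT, hT', hT1⟩ := h _ hopen (by simp [hδ])
  exact ⟨T, hT', hT1, by simpa using hT⟩

end Words

-- Displacements of prescribed size and their iteration

section Steps

variable {E ι : Type*} [NormedAddCommGroup E] [NormedSpace ℝ E] [FiniteDimensional ℝ E] [Finite ι]
  {S : ι → (E ≃ᵈ E)} {F : Set E}

/-- After any word `w` and at any scale `ε` there are two words whose maps differ by a
displacement comparable to `ε` in a direction that is nearly constant on a unit ball. -/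
theorem exists_displacement_step (hS : ∀ i, ratio (S i) < 1) (hF : IsAttractor S F)
    {x : E} (hx : x ∈ F) (hspan : ⊤ ≤ Submodule.span ℝ ((fun p => p - x) '' F))
    (hWSP : ¬ WeakSeparationProperty S) {D : Finset (E →L[ℝ] ℝ)} (hD1 : ∀ f ∈ D, ‖f‖ ≤ 1)
    (hD : ∀ z, ∃ f ∈ D, ‖z‖ / 2 ≤ f z) :
    ∃ κ : ℝ, 0 < κ ∧ ∀ ε : ℝ, 0 < ε → ∀ w : List ι, ∃ a b : List ι, ∃ f ∈ D,
      ∀ y, ‖y - x‖ ≤ 1 →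
        ‖((wordMap S (a ++ w))⁻¹ * wordMap S (b ++ w)) y - y‖ ≤ ε ∧
        κ * ε ≤ f (((wordMap S (a ++ w))⁻¹ * wordMap S (b ++ w)) y - y) := by
  obtain ⟨Y, hYF, C, hC, hY⟩ := exists_finset_displacement_bound hx hspan
  have hcyl : ∀ p : Y, ∃ γ : List ι, (ratio (wordMap S γ) : ℝ) ≤ 1 / (8 * C) ∧
      ∀ y ∈ F, dist (wordMap S γ y) p ≤ 1 / (8 * C) := fun p =>
    hF.exists_cylinder_subset hS (hYF p.2) (by positivity)
  choose γ hγ hγF using hcyl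
  obtain ⟨i₀⟩ : Nonempty ι := by
    rw [hF.2.2] at hx
    obtain ⟨i, -⟩ := Set.mem_iUnion.1 hx
    exact ⟨i⟩
  have hσ0 : (0 : ℝ) < ratio (S i₀) := by exact_mod_cast Dilation.ratio_pos (S i₀)
  have hσ1 : (ratio (S i₀) : ℝ) < 1 := by exact_mod_cast hS i₀
  set σ : ℝ := ((ratio (S i₀) : ℝ≥0) : ℝ)
  refine ⟨σ / 8, by positivity, fun ε hε w => ?_⟩
  have hw0 : (0 : ℝ) < ratio (wordMap S w) := by exact_mod_cast Dilation.ratio_pos (wordMap S w)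
  set cw : ℝ := ((ratio (wordMap S w) : ℝ≥0) : ℝ)
  obtain ⟨c₀, hc₀, hc₀γ⟩ : ∃ c₀ : ℝ, 0 < c₀ ∧ ∀ p, c₀ ≤ ratio (wordMap S (γ p)) := by
    rcases isEmpty_or_nonempty Y with hE | hE
    · exact ⟨1, one_pos, fun p => hE.elim p⟩
    · obtain ⟨p, hp⟩ := Finite.exists_min fun p => ratio (wordMap S (γ p))
      exact ⟨ratio (wordMap S (γ p)), by exact_mod_cast Dilation.ratio_pos _,
        fun q => by exact_mod_cast hp q⟩
  -- This `δ` makes `2 * lam / (ε * cγ * cw)` at most `1` whichever `p` is selected, so that an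
  -- exponent `k` exists.
  obtain ⟨T, ⟨α, β, -, -, -, hTαβ⟩, hT1, hTY⟩ :=
    exists_wordQuotient_near_one hWSP Y (δ := ε * c₀ * cw / 2) (by positivity)
  obtain ⟨p, hp, hpos, hlip⟩ := hY T hT1
  have hsmall := hTY p hp
  rw [dist_eq_norm] at hsmall
  set lam : ℝ := ‖T p - p‖
  set cγ : ℝ := ((ratio (wordMap S (γ ⟨p, hp⟩)) : ℝ≥0) : ℝ)
  have hcγ0 : c₀ ≤ cγ := hc₀γ ⟨p, hp⟩
  have hcγpos : 0 < cγ := hc₀.trans_le hcγ0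
  have hcγC : cγ ≤ 1 / (8 * C) := hγ ⟨p, hp⟩
  obtain ⟨k, hk1, hk2⟩ := exists_nat_pow_near_of_lt_one
    (x := 2 * lam / (ε * cγ * cw)) (by positivity) (by
      rw [div_le_one (by positivity)]
      have : ε * c₀ * cw ≤ ε * cγ * cw := by gcongr
      linarith) hσ0 hσ1
  rw [lt_div_iff₀ (by positivity), pow_succ] at hk1
  rw [div_le_iff₀ (by positivity)] at hk2
  -- The prefix `γ p` places the image near `p`; the `k` repeated letters only adjust the ratio.
  set v : List ι := γ ⟨p, hp⟩ ++ List.replicate k i₀ with hv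
  set A := wordMap S (v ++ w) with hA
  have hcA : (ratio A : ℝ) = cγ * σ ^ k * cw := by
    rw [hA, hv, wordMap_append, wordMap_append, ratio_mul, ratio_mul, ratio_wordMap_replicate]
    push_cast
    rfl
  set cA : ℝ := ((ratio A : ℝ≥0) : ℝ) with hcAdef
  have hcA0 : 0 < cA := by exact_mod_cast Dilation.ratio_pos A
  have hcAC : cA ≤ 1 / (8 * C) := by
    have h1 : cw ≤ 1 := by exact_mod_cast ratio_wordMap_le_one hS w
    have h2 : σ ^ k ≤ 1 := pow_le_one₀ hσ0.le hσ1.le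
    have h3 : cγ * σ ^ k * cw ≤ cγ * 1 * 1 := by gcongr
    rw [hcA]
    linarith
  have hAx : ‖A x - p‖ ≤ 1 / (8 * C) := by
    rw [← dist_eq_norm, hA, hv, List.append_assoc, wordMap_append]
    exact hγF ⟨p, hp⟩ _ (hF.wordMap_mem _ hx)
  -- The common suffix `v ++ w` conjugates `T`, and the conjugate remains a quotient of word maps.
  have hU : (wordMap S ((α ++ v) ++ w))⁻¹ * wordMap S ((β ++ v) ++ w) = A⁻¹ * (T * A) := by
    rw [List.append_assoc α, List.append_assoc β, wordMap_append, wordMap_append S β, hTαβ, ← hA]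
    group
  set U := A⁻¹ * (T * A) with hUdef
  have hgx : ‖(T (A x) - A x) - (T p - p)‖ ≤ lam / 8 := by
    refine (hlip _ _).trans ?_
    calc C * lam * ‖A x - p‖ ≤ C * lam * (1 / (8 * C)) := by gcongr
      _ = lam / 8 := by field_simp
  have hg1 : ‖T (A x) - A x‖ ≤ 9 / 8 * lam := by
    have := norm_sub_norm_le (T (A x) - A x) (T p - p)
    linarith
  have hg2 : 7 / 8 * lam ≤ ‖T (A x) - A x‖ := by
    have := norm_sub_norm_le (T p - p) (T (A x) - A x)
    rw [norm_sub_rev (T p - p) (T (A x) - A x)] at this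
    linarith
  -- `μ` is the magnified displacement. The choice of `k` puts `2 * μ` between `σ * ε` and `ε`; the
  -- displacement differs from size `μ` by at most `μ / 8` at `x`, and varies by at most another `μ
  -- / 8` over the ball.
  set μ : ℝ := cA⁻¹ * lam with hμ
  have hμ1 : 2 * μ ≤ ε := by
    rw [hμ, ← div_eq_inv_mul, ← mul_div_assoc, div_le_iff₀ hcA0, hcA]
    linarith
  have hμ2 : σ * ε ≤ 2 * μ := by
    rw [hμ, ← div_eq_inv_mul, ← mul_div_assoc, le_div_iff₀ hcA0, hcA]
    linarith
  have hz : ‖U x - x‖ = cA⁻¹ * ‖T (A x) - A x‖ := DilationEquiv.norm_conj_displacement A T x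
  have hz1 : ‖U x - x‖ ≤ 9 / 8 * μ := by
    rw [hz, hμ, mul_left_comm]
    gcongr
  have hz2 : 7 / 8 * μ ≤ ‖U x - x‖ := by
    rw [hz, hμ, mul_left_comm]
    gcongr
  obtain ⟨f, hfD, hf⟩ := hD (U x - x)
  refine ⟨α ++ v, β ++ v, f, hfD, fun y hy => ?_⟩
  rw [hU]
  have hvar : ‖(U y - y) - (U x - x)‖ ≤ μ / 8 := by
    rw [hUdef, DilationEquiv.norm_conj_displacement_sub, ← hcAdef]
    have h1 := hlip (A y) (A x)
    have h2 : ‖A y - A x‖ = cA * ‖y - x‖ := by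
      rw [← dist_eq_norm, Dilation.dist_eq, dist_eq_norm]
    rw [h2] at h1
    have h3 : C * lam * (cA * ‖y - x‖) ≤ C * lam * (1 / (8 * C) * 1) := by gcongr
    have h4 : C * lam * (1 / (8 * C) * 1) = lam / 8 := by field_simp
    rw [hμ, mul_div_assoc]
    gcongr
    linarith
  constructor
  · have := norm_sub_norm_le (U y - y) (U x - x)
    have hμ0 : 0 < μ := by positivity
    linarith
  · have h1 : ‖f ((U y - y) - (U x - x))‖ ≤ μ / 8 := by
      refine (f.le_opNorm _).trans ?_
      calc ‖f‖ * ‖(U y - y) - (U x - x)‖ ≤ 1 * (μ / 8) := by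
            gcongr
            exact hD1 f hfD
        _ = μ / 8 := one_mul _
    rw [map_sub, Real.norm_eq_abs] at h1
    have h2 := neg_abs_le (f (U y - y) - f (U x - x))
    have hμ0 : 0 < μ := by positivity
    linarith

/-- Some small ball around a point of the attractor contains `N` points of the attractor with
mutual distances comparable to `1 / N` times the radius. -/
theorem exists_separated_points [Nontrivial E] (hS : ∀ i, ratio (S i) < 1) (hF : IsAttractor S F)
    {x : E} (hx : x ∈ F) (hspan : ⊤ ≤ Submodule.span ℝ ((fun p => p - x) '' F))
    (hWSP : ¬ WeakSeparationProperty S) :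
    ∃ κ : ℝ, 0 < κ ∧ ∀ N : ℕ, 0 < N → ∃ r : ℝ, 0 < r ∧ r ≤ 1 ∧ ∃ x₀ ∈ F, ∃ J : Finset ℕ,
      ∃ q : ℕ → E, N ≤ J.card ∧ (∀ n ∈ J, q n ∈ F ∩ Metric.ball x₀ r) ∧
        ∀ n ∈ J, ∀ n' ∈ J, n < n' → κ * r / N ≤ dist (q n) (q n') := by
  classical
  obtain ⟨D, hDne, hD1, hD⟩ := exists_finset_norming (E := E)
  obtain ⟨κ, hκ, hstep⟩ := exists_displacement_step hS hF hx hspan hWSP hD1 hD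
  have hm : 0 < D.card := hDne.card_pos
  refine ⟨κ / (2 * D.card), by positivity, fun N hN => ?_⟩
  set M : ℕ := D.card * N with hM
  have hM0 : (0 : ℝ) < M := by exact_mod_cast Nat.mul_pos hm hN
  -- With this size, `M` moves stay within `1 / 2` of `x`, where the step estimates are valid.
  set ε : ℝ := 1 / (2 * M) with hε
  have hε0 : 0 < ε := by positivity
  choose a b f hfD hf using hstep ε hε0
  let w : ℕ → List ι := fun n => Nat.rec [] (fun _ u => a u ++ u) n
  have hw : ∀ n, w (n + 1) = a (w n) ++ w n := fun n => rfl
  obtain ⟨f₀, hf₀, hJ⟩ := Finset.exists_le_card_fiber_of_mul_le_card_of_maps_to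
    (s := Finset.range M) (t := D) (f := fun n => f (w n)) (n := N)
    (fun n _ => hfD _) hDne (by simp [hM])
  let U : ℕ → (E ≃ᵈ E) := fun n => (wordMap S (w (n + 1)))⁻¹ * wordMap S (b (w n) ++ w n)
  -- Moves are made only in steps detected by `f₀`, so that they cannot cancel.
  let q : ℕ → E := fun n => Nat.rec x (fun n y => if f (w n) = f₀ then U n y else y) n
  have hq : ∀ n, q (n + 1) = if f (w n) = f₀ then U n (q n) else q n := fun n => rfl
  have hUn : ∀ n y, ‖y - x‖ ≤ 1 → ‖U n y - y‖ ≤ ε ∧ κ * ε ≤ f (w n) (U n y - y) :=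
    fun n y hy => hf (w n) y hy
  have hMε : (M : ℝ) * ε = 1 / 2 := by rw [hε]; field_simp
  have hdist : ∀ n ≤ M, ‖q n - x‖ ≤ n * ε := by
    intro n
    induction n with
    | zero => intro _; simp [q]
    | succ n ih =>
      intro hn
      have h1 := ih (by omega)
      have hnM : ((n : ℝ) + 1) * ε ≤ M * ε := by
        gcongr
        exact_mod_cast hn
      push_cast
      rw [hq]
      split_ifs with h
      · have h2 := (hUn n (q n) (by linarith)).1
        have h3 := norm_add_le (U n (q n) - q n) (q n - x)
        rw [sub_add_sub_cancel] at h3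
        linarith
      · linarith
  have hdist' : ∀ n ≤ M, ‖q n - x‖ ≤ 1 / 2 := fun n hn => by
    refine (hdist n hn).trans ?_
    rw [← hMε]
    gcongr
  have hlift : ∀ n k (y : E), n ≤ k → wordMap S (w n) y ∈ F → wordMap S (w k) y ∈ F := by
    intro n k y hnk hy
    induction k, hnk using Nat.le_induction with
    | base => exact hy
    | succ k _ ih =>
      rw [hw, wordMap_append]
      exact hF.wordMap_mem _ ih
  have hqF : ∀ n, wordMap S (w n) (q n) ∈ F := by
    intro n
    induction n with
    | zero => exact hF.wordMap_mem _ hx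
    | succ n ih =>
      rw [hq]
      split_ifs with h
      · have : wordMap S (w (n + 1)) (U n (q n)) = wordMap S (b (w n) ++ w n) (q n) := by
          simp [U, DilationEquiv.coe_inv]
        rw [this, wordMap_append]
        exact hF.wordMap_mem _ ih
      · exact hlift n (n + 1) _ n.le_succ ih
  have hmono : ∀ n k, n ≤ k → k ≤ M → f₀ (q n) ≤ f₀ (q k) := by
    intro n k hnk
    induction k, hnk using Nat.le_induction with
    | base => exact fun _ => le_rfl
    | succ k _ ih =>
      intro hkM
      refine (ih (by omega)).trans ?_
      rw [hq]
      split_ifs with h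
      · have h2 := (hUn k (q k) (by linarith [hdist' k (by omega)])).2
        rw [h, map_sub] at h2
        have : 0 < κ * ε := by positivity
        linarith
      · exact le_rfl
  set P := wordMap S (w M)
  have hr0 : (0 : ℝ) < ratio P := by exact_mod_cast Dilation.ratio_pos P
  -- The point `q (n + 1)` is the one just after move `n`, so distinct indices in the fibre are
  -- separated by at least one move.
  refine ⟨ratio P, hr0, by exact_mod_cast ratio_wordMap_le_one hS (w M), P x,
    hF.wordMap_mem _ hx, {n ∈ Finset.range M | f (w n) = f₀}, fun n => P (q (n + 1)), hJ, ?_, ?_⟩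
  · intro n hn
    have hnM : n < M := Finset.mem_range.1 (Finset.mem_filter.1 hn).1
    refine ⟨hlift (n + 1) M _ hnM (hqF (n + 1)), ?_⟩
    rw [Metric.mem_ball, Dilation.dist_eq, dist_eq_norm]
    nlinarith [hdist' (n + 1) hnM]
  · intro n hn n' hn' hlt
    have hnM : n' < M := Finset.mem_range.1 (Finset.mem_filter.1 hn').1
    have hn'f : f (w n') = f₀ := (Finset.mem_filter.1 hn').2
    have h1 := hmono (n + 1) n' hlt hnM.le
    have h2 := (hUn n' (q n') (by linarith [hdist' n' hnM.le])).2
    have h3 : q (n' + 1) = U n' (q n') := by rw [hq, if_pos hn'f]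
    rw [hn'f, ← h3, map_sub] at h2
    have h4 : f₀ (q (n' + 1) - q (n + 1)) ≤ ‖q (n' + 1) - q (n + 1)‖ := by
      refine (le_abs_self _).trans ((f₀.le_opNorm _).trans ?_)
      exact mul_le_of_le_one_left (norm_nonneg _) (hD1 f₀ hf₀)
    rw [map_sub] at h4
    rw [Dilation.dist_eq, dist_comm, dist_eq_norm]
    have h5 : κ / (2 * D.card) * ratio P / N = ratio P * (κ * ε) := by
      rw [hε, hM]
      push_cast
      field_simp
    rw [h5]
    gcongr
    linarith

end Steps

-- From separated points to Assouad dimension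

section Dimension

variable {X : Type*} [MetricSpace X]

/-- An open ball of radius `ρ` contains at most one of the points, so choosing a covering centre for
each is injective. -/
theorem le_openCoverNumber_of_separated {A : Set X} {ρ : ℝ} {J : Finset ℕ} {q : ℕ → X}
    (hq : ∀ n ∈ J, q n ∈ A) (hsep : ∀ n ∈ J, ∀ n' ∈ J, n < n' → 2 * ρ ≤ dist (q n) (q n')) :
    (J.card : ℕ∞) ≤ openCoverNumber A ρ := by
  refine le_iInf₂ fun C hC => ?_
  have hcen : ∀ n ∈ J, ∃ c ∈ C, dist (q n) c < ρ := fun n hn => by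
    obtain ⟨c, hc, h⟩ := Set.mem_iUnion₂.1 (hC (hq n hn))
    exact ⟨c, hc, h⟩
  have : Nonempty X := ⟨q 0⟩
  choose! c hcC hc using hcen
  rw [← Set.encard_coe_eq_coe_finsetCard]
  refine Set.encard_le_encard_of_injOn (f := c) (fun n hn => hcC n hn) ?_
  have hne : ∀ n ∈ J, ∀ n' ∈ J, n < n' → c n ≠ c n' := fun n hn n' hn' hlt h => by
    have h1 := hc n hn
    have h2 := hc n' hn'
    rw [← h] at h2
    have h3 := dist_triangle_right (q n) (q n') (c n)
    linarith [hsep n hn n' hn' hlt]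
  intro n hn n' hn' h
  rcases lt_trichotomy n n' with hlt | heq | hgt
  · exact (hne n hn n' hn' hlt h).elim
  · exact heq
  · exact (hne n' hn' n hn hgt h.symm).elim

/-- Taking `ρ` to be half the separation gives `N ≤ K * (2 * N / κ) ^ s` for all large `N`, which is
impossible when `s < 1`. -/
theorem one_le_assouadDim_of_separated {A : Set X} {κ : ℝ} (hκ : 0 < κ)
    (h : ∀ N : ℕ, 0 < N → ∃ r : ℝ, 0 < r ∧ r ≤ 1 ∧ ∃ x₀ ∈ A, ∃ J : Finset ℕ,
      ∃ q : ℕ → X, N ≤ J.card ∧ (∀ n ∈ J, q n ∈ A ∩ Metric.ball x₀ r) ∧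
        ∀ n ∈ J, ∀ n' ∈ J, n < n' → κ * r / N ≤ dist (q n) (q n')) :
    1 ≤ assouadDim A := by
  refine le_iInf₂ fun s ⟨K, hK⟩ => ?_
  by_contra hs
  have hs1 : (s : ℝ) < 1 := by
    have : s < 1 := by simpa using hs
    exact_mod_cast this
  have hbound : ∀ N : ℕ, κ < N → (N : ℝ) ^ (1 - (s : ℝ)) ≤ K * (2 / κ) ^ (s : ℝ) := by
    intro N hN
    have hN0 : (0 : ℝ) < N := hκ.trans hN
    obtain ⟨r, hr0, hr1, x₀, hx₀, J, q, hJ, hq, hsep⟩ := h N (by exact_mod_cast hN0)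
    have hρ : κ * r / (2 * N) < r := by
      rw [div_lt_iff₀ (by positivity)]
      nlinarith
    have h1 := hK r (κ * r / (2 * N)) (by positivity) hρ hr1
    have h2 : (J.card : ℕ∞) ≤ openCoverNumber (A ∩ Metric.ball x₀ r) (κ * r / (2 * N)) :=
      le_openCoverNumber_of_separated hq fun n hn n' hn' hlt => by
        refine le_of_eq_of_le ?_ (hsep n hn n' hn' hlt)
        field_simp
    have h3 : (N : ℕ∞) ≤ localCoverNumber A r (κ * r / (2 * N)) :=
      ((Nat.cast_le.2 hJ).trans h2).trans
        (le_iSup₂ (f := fun x (_ : x ∈ A) => openCoverNumber (A ∩ Metric.ball x r) _) x₀ hx₀)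
    have h4 : ((N : ℕ∞) : ℝ≥0∞) ≤ K * ENNReal.ofReal ((r / (κ * r / (2 * N))) ^ (s : ℝ)) :=
      (ENat.toENNReal_le.2 h3).trans h1
    have h5 : r / (κ * r / (2 * N)) = 2 / κ * N := by field_simp
    rw [h5, ENat.toENNReal_coe, ← ENNReal.ofReal_natCast, ← ENNReal.ofReal_coe_nnreal,
      ← ENNReal.ofReal_mul (NNReal.coe_nonneg K), ENNReal.ofReal_le_ofReal_iff (by positivity),
      Real.mul_rpow (by positivity) hN0.le, ← mul_assoc] at h4
    rw [Real.rpow_sub hN0, Real.rpow_one, div_le_iff₀ (by positivity)]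
    exact h4
  have hlim : Filter.Tendsto (fun N : ℕ => (N : ℝ) ^ (1 - (s : ℝ))) Filter.atTop Filter.atTop :=
    (tendsto_rpow_atTop (by linarith)).comp tendsto_natCast_atTop_atTop
  obtain ⟨N, hN1, hN2⟩ := ((hlim.eventually_gt_atTop (K * (2 / κ) ^ (s : ℝ))).and
    (tendsto_natCast_atTop_atTop.eventually_gt_atTop κ)).exists
  exact absurd (hbound N hN2) (not_le.2 hN1)

end Dimension

-- Hyperplanes and the conclusion in Euclidean space

/-- The differences of points of a set that lies in no hyperplane span the whole space. -/
theorem span_sub_eq_top_of_forall_hyperplane {d : ℕ} {F : Set (EuclideanSpace ℝ (Fin d))}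
    (hplane : ∀ H : AffineSubspace ℝ (EuclideanSpace ℝ (Fin d)),
      IsAffineHyperplane H → ¬ F ⊆ (H : Set (EuclideanSpace ℝ (Fin d))))
    (x : EuclideanSpace ℝ (Fin d)) : Submodule.span ℝ ((fun p => p - x) '' F) = ⊤ := by
  by_contra hne
  obtain ⟨f, hf0, hf⟩ := Submodule.exists_le_ker_of_lt_top _ (lt_top_iff_ne_top.2 hne)
  refine hplane (AffineSubspace.mk' x (LinearMap.ker f))
    ⟨⟨x, AffineSubspace.self_mem_mk' _ _⟩, ?_⟩ fun p hp => ?_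
  · rw [AffineSubspace.direction_mk', Module.Dual.finrank_ker_add_one_of_ne_zero hf0]
    simp
  · exact hf (Submodule.subset_span ⟨p, hp, rfl⟩)

theorem theorem5 {d : ℕ} {ι : Type*} [Finite ι]
    (S : ι → (EuclideanSpace ℝ (Fin d) ≃ᵈ EuclideanSpace ℝ (Fin d)))
    (hS : ∀ i, IsContractingSimilarity (S i))
    (F : Set (EuclideanSpace ℝ (Fin d))) (hF : IsAttractor S F)
    (hplane : ∀ H : AffineSubspace ℝ (EuclideanSpace ℝ (Fin d)),
      IsAffineHyperplane H → ¬ F ⊆ (H : Set (EuclideanSpace ℝ (Fin d))))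
    (hWSP : ¬ WeakSeparationProperty S) :
    1 ≤ assouadDim F := by
  -- A similarity other than the identity rules out `d = 0`, where `ratio` takes its default value
  -- `1` and says nothing about contraction.
  obtain ⟨T, -, hT1, -⟩ := exists_wordQuotient_near_one hWSP ∅ one_pos
  have : Nontrivial (EuclideanSpace ℝ (Fin d)) := by
    by_contra hn
    rw [not_nontrivial_iff_subsingleton] at hn
    exact hT1 (DilationEquiv.ext fun x => Subsingleton.elim _ _)
  have hratio : ∀ i, Dilation.ratio (S i) < 1 := fun i => by
    obtain ⟨c, -, hc1, hc⟩ := hS i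
    obtain ⟨x, y, hxy⟩ := exists_pair_ne (EuclideanSpace ℝ (Fin d))
    have h := hc x y
    rw [Dilation.dist_eq] at h
    have h' := mul_right_cancel₀ (dist_ne_zero.2 hxy) h
    exact_mod_cast h'.trans_lt hc1
  obtain ⟨x, hx⟩ := hF.1
  obtain ⟨κ, hκ, h⟩ := exists_separated_points hratio hF hx
    (span_sub_eq_top_of_forall_hyperplane hplane x).ge hWSP
  exact one_le_assouadDim_of_separated hκ h
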